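/- Let $(X,d)$ be a locally compact, noncompact, complete metric space with at least two points, and let $\mu$ be a complete measure on a $\sigma$-algebra containing the Borel sets of $X$. Assume that $\mu$ is doubling, i.e. there is a constant $C$ with $\mu(B_{2r}(x))\le C\mu(B_r(x))$ for all $x\in X$, $r>0$, and that $0<\mu(B_r(x))<\infty$ for all open balls. Let $1<p<\infty$. The $p$-modulus of a family $\Gamma$ of locally rectifiable curves in $X$ is $\mathrm{Mod}_p(\Gamma)=\inf_\rho\int_X\rho^p\,d\mu$, the infimum over all Borel functions $\rho:X\to[0,\infty]$ with $\int_\gamma\rho\,ds\ge 1$ for every $\gamma\in\Gamma$. A Borel function $g:X\to[0,\infty]$ is a $p$-weak upper gradient of $u:X\to\mathbb R$ if the family of rectifiable curves $\gamma:[a,b]\to X$ for which $|u(\gamma(b))-u(\gamma(a))|\le\int_\gamma g\,ds$ fails has $p$-modulus zero. A $p$-weak upper gradient of $u$ that is $p$-integrable on compact sets is minimal, and is denoted by $|\nabla u|$, if it is $\mu$-a.e. less than or equal to every $p$-weak upper gradient of $u$ that is $p$-integrable on compact sets; it is unique up to $\mu$-null sets. Let $BD^p(X)$ be the set of bounded continuous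 functions $u:X\to\mathbb R$ that have a minimal $p$-weak upper gradient $|\nabla u|$ with $\int_X|\nabla u|^p\,d\mu<\infty$. A sequence $(u_n)$ of real-valued functions on $X$ converges to $u:X\to\mathbb R$ in the $BD^p$-topology if $(u_n)$ is uniformly bounded on $X$, $\sup_K|u_n-u|\to0$ for every compact $K\subset X$, and $\int_X|\nabla(u_n-u)|^p\,d\mu\to0$ (the integral being $\infty$ if $u_n-u$ has no minimal $p$-weak upper gradient). Let $(u_n)$ be a sequence in $BD^p(X)$ that is uniformly bounded on $X$, let $u$ be a real-valued function on $X$, and suppose that $(u_n)\to u$ in the $BD^p$-topology. Then $u\in BD^p(X)$. -/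

import Mathlib

open MeasureTheory Filter Topology
open scoped ENNReal NNReal

noncomputable section

namespace Royden

/-- A locally rectifiable curve in `X`: a continuous map on a nonempty interval `dom ⊆ ℝ`, all of
whose restrictions to compact subintervals have finite length. Only the values of `toFun` on `dom`
matter. -/
structure Curve (X : Type*) [MetricSpace X] where
  dom : Set ℝ
  toFun : ℝ → X
  nonempty : dom.Nonempty
  ordConnected : dom.OrdConnected
  continuousOn : ContinuousOn toFun dom
  locallyRectifiable : LocallyBoundedVariationOn toFun dom

/-- The integral of `ρ` with respect to arc length along `f` restricted to `[a, b]`: the integral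
over `[0, length]` of `ρ` composed with the arc length parametrization. -/
def arcIntegral {X : Type*} [MetricSpace X] (ρ : X → ℝ≥0∞) (f : ℝ → X) (a b : ℝ) : ℝ≥0∞ :=
  ∫⁻ s in Set.Icc 0 (eVariationOn f (Set.Icc a b)).toReal,
    ρ (naturalParameterization f (Set.Icc a b) a s)

/-- The line integral `∫_γ ρ ds` along a locally rectifiable curve: the supremum of the integrals
along its compact subcurves (if the domain of `γ` is `[a, b]`, this is the integral along `γ`
itself). -/
def lineIntegral {X : Type*} [MetricSpace X] (ρ : X → ℝ≥0∞) (γ : Curve X) : ℝ≥0∞ :=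
  ⨆ (a : ℝ) (b : ℝ) (_ : a ∈ γ.dom) (_ : b ∈ γ.dom) (_ : a ≤ b), arcIntegral ρ γ.toFun a b

/-- Borel functions `ρ : X → [0, ∞]` with `∫_γ ρ ds ≥ 1` for every `γ ∈ Γ`. -/
def Admissible {X : Type*} [MetricSpace X] (Γ : Set (Curve X)) : Set (X → ℝ≥0∞) :=
  {ρ | Measurable[borel X] ρ ∧ ∀ γ ∈ Γ, 1 ≤ lineIntegral ρ γ}

/-- The `p`-modulus of a family of curves. -/
def modulus {X : Type*} [MetricSpace X] [MeasurableSpace X] (μ : Measure X) (p : ℝ)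
    (Γ : Set (Curve X)) : ℝ≥0∞ :=
  ⨅ ρ ∈ Admissible Γ, ∫⁻ x, ρ x ^ p ∂μ

/-- A property holds for `p`-almost every curve if the family where it fails has zero modulus. -/
def AlmostEveryCurve {X : Type*} [MetricSpace X] [MeasurableSpace X] (μ : Measure X) (p : ℝ)
    (P : Curve X → Prop) : Prop :=
  modulus μ p {γ | ¬ P γ} = 0

/-- `g` is a `p`-weak upper gradient of `u`: a Borel function with
`|u (γ b) - u (γ a)| ≤ ∫_γ g ds` for `p`-almost every rectifiable curve `γ : [a, b] → X`. -/
def IsWeakUpperGradient {X : Type*} [MetricSpace X] [MeasurableSpace X] (μ : Measure X) (p : ℝ)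
    (u : X → ℝ) (g : X → ℝ≥0∞) : Prop :=
  Measurable[borel X] g ∧
    AlmostEveryCurve μ p fun γ => ∀ a b : ℝ, a ≤ b → γ.dom = Set.Icc a b →
      ENNReal.ofReal |u (γ.toFun b) - u (γ.toFun a)| ≤ lineIntegral g γ

/-- `g` is `p`-integrable on compact sets. -/
def LocallyPIntegrable {X : Type*} [MetricSpace X] [MeasurableSpace X] (μ : Measure X) (p : ℝ)
    (g : X → ℝ≥0∞) : Prop :=
  ∀ K : Set X, IsCompact K → ∫⁻ x in K, g x ^ p ∂μ < ∞

/-- `g` is a minimal `p`-weak upper gradient of `u` (a version of `|∇u|`): it is a.e. the smallest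
among the locally `p`-integrable `p`-weak upper gradients of `u`. Without local integrability of
the competitors the notion would be wrong: on `ℝ` there are a.e. finite Borel functions `f` with
infinite integral over every interval, and then `ε f` is an upper gradient of every function. -/
def IsMinimalWeakUpperGradient {X : Type*} [MetricSpace X] [MeasurableSpace X] (μ : Measure X)
    (p : ℝ) (u : X → ℝ) (g : X → ℝ≥0∞) : Prop :=
  IsWeakUpperGradient μ p u g ∧ LocallyPIntegrable μ p g ∧
    ∀ g₁ : X → ℝ≥0∞, IsWeakUpperGradient μ p u g₁ → LocallyPIntegrable μ p g₁ → g ≤ᵐ[μ] g₁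

/-- The `p`-energy `∫_X |∇u|^p dμ`. Minimal `p`-weak upper gradients agree a.e., so that the infimum
is over one value if there is one, and it is `∞` if there is none. -/
def energy {X : Type*} [MetricSpace X] [MeasurableSpace X] (μ : Measure X) (p : ℝ)
    (u : X → ℝ) : ℝ≥0∞ :=
  ⨅ (g : X → ℝ≥0∞) (_ : IsMinimalWeakUpperGradient μ p u g), ∫⁻ x, g x ^ p ∂μ

/-- The `p`-Royden algebra `BD^p(X)`: bounded continuous functions with a minimal `p`-weak upper
gradient in `L^p`. -/
def BD {X : Type*} [MetricSpace X] [MeasurableSpace X] (μ : Measure X) (p : ℝ) : Set (X → ℝ) :=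
  {u | Continuous u ∧ (∃ M : ℝ, ∀ x, |u x| ≤ M) ∧
    ∃ g : X → ℝ≥0∞, IsMinimalWeakUpperGradient μ p u g ∧ ∫⁻ x, g x ^ p ∂μ < ∞}

/-- A sequence of functions is uniformly bounded. -/
def UniformlyBounded {X : Type*} (u : ℕ → X → ℝ) : Prop :=
  ∃ M : ℝ, ∀ n x, |u n x| ≤ M

/-- Convergence in the `CD^p`-topology. -/
def TendstoCD {X : Type*} [MetricSpace X] [MeasurableSpace X] (μ : Measure X) (p : ℝ)
    (u : ℕ → X → ℝ) (v : X → ℝ) : Prop :=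
  (∀ K : Set X, IsCompact K → TendstoUniformlyOn u v atTop K) ∧
    Tendsto (fun n => energy μ p (fun x => u n x - v x)) atTop (𝓝 0)

/-- Convergence in the `BD^p`-topology. -/
def TendstoBD {X : Type*} [MetricSpace X] [MeasurableSpace X] (μ : Measure X) (p : ℝ)
    (u : ℕ → X → ℝ) (v : X → ℝ) : Prop :=
  TendstoCD μ p u v ∧ UniformlyBounded u

/-- The measure is doubling. -/
def IsDoubling {X : Type*} [MetricSpace X] [MeasurableSpace X] (μ : Measure X) : Prop :=
  ∃ C : ℝ≥0, ∀ (x : X) (r : ℝ), 0 < r → μ (Metric.ball x (2 * r)) ≤ C * μ (Metric.ball x r)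

end Royden

end

/-! Continuity and boundedness of `v` come from locally uniform convergence; the substance is a
minimal weak upper gradient of `v` in `L^p`. It is constructed directly, by comparing minimal
gradients. Along suitable indices, let `g n` be minimal for `u n` and `h n` for `u n - v`, with `h n
≤ 2⁻¹ ^ n * H` for some `H` in `L^p`. Each `g n + h n` is a weak upper gradient of `v`, and
minimality of `g n` gives `g n ≤ g' + h n` a.e. for every locally `p`-integrable competitor `g'` for
`v`. Put `G = ⨅ n, (g n + h n)`. Taking `g' = g m + h m` yields `g n + h n ≤ G + 2 * h n` a.e. Since
`H` has finite integral along `p`-almost every curve, integrating and letting `n → ∞` shows that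
`G`, corrected on a null set, is a weak upper gradient (`isWeakUpperGradient_of_le_add`). Also `G ≤
g' + 2 * h n` a.e., so `G ≤ g'` a.e., which is minimality. -/

namespace Royden

/-! ### Arc length parametrization -/

section ArcLength

variable {X : Type*} [MetricSpace X] {f : ℝ → X} {a b : ℝ}

/-- The variation over a shrinking one-sided interval tends to the jump of `f` at its endpoint,
which is zero by continuity. -/
lemma continuousOn_variationOnFromTo {s : Set ℝ} (hf : ContinuousOn f s)
    (hbv : LocallyBoundedVariationOn f s) (ha : a ∈ s) :
    ContinuousOn (variationOnFromTo f s a) s := by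
  intro x hx
  have hsplit : 𝓝[s] x ≤ 𝓝[s ∩ Set.Iio x] x ⊔ (𝓝[s ∩ Set.Ioi x] x ⊔ pure x) := by
    rw [← nhdsWithin_singleton, ← nhdsWithin_union, ← nhdsWithin_union]
    refine nhdsWithin_mono x fun y hy => ?_
    rcases lt_trichotomy y x with h | h | h
    · exact Or.inl ⟨hy, h⟩
    · exact Or.inr (Or.inr h)
    · exact Or.inr (Or.inl ⟨hy, h⟩)
  refine Tendsto.mono_left ?_ hsplit
  refine Tendsto.sup ?_ (Tendsto.sup ?_ (tendsto_pure_nhds _ _))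
  · have h := hbv.tendsto_eVariationOn_Icc_left ((hf x hx).mono_left
      (nhdsWithin_mono x Set.inter_subset_left)) hx
    rw [edist_self] at h
    have h' := ((ENNReal.tendsto_toReal ENNReal.zero_ne_top).comp h).const_sub
      (variationOnFromTo f s a x)
    rw [ENNReal.toReal_zero, sub_zero] at h'
    refine h'.congr' ?_
    filter_upwards [self_mem_nhdsWithin] with y hy
    have := variationOnFromTo.add hbv ha hy.1 hx
    rw [variationOnFromTo.eq_of_le f s (le_of_lt hy.2 : y ≤ x)] at this
    simp only [Function.comp_apply]
    linarith
  · have h := hbv.tendsto_eVariationOn_Icc_right ((hf x hx).mono_left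
      (nhdsWithin_mono x Set.inter_subset_left)) hx
    rw [edist_self] at h
    have h' := ((ENNReal.tendsto_toReal ENNReal.zero_ne_top).comp h).const_add
      (variationOnFromTo f s a x)
    rw [ENNReal.toReal_zero, add_zero] at h'
    refine h'.congr' ?_
    filter_upwards [self_mem_nhdsWithin] with y hy
    have := variationOnFromTo.add hbv ha hx hy.1
    rw [variationOnFromTo.eq_of_le f s (le_of_lt hy.2 : x ≤ y)] at this
    simp only [Function.comp_apply]
    linarith

lemma variationOnFromTo_Icc {c y : ℝ} (hc : a ≤ c) (hcy : c ≤ y) (hy : y ≤ b) :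
    variationOnFromTo f (Set.Icc a b) c y = (eVariationOn f (Set.Icc c y)).toReal := by
  rw [variationOnFromTo.eq_of_le _ _ hcy, Set.inter_eq_self_of_subset_right
    (Set.Icc_subset_Icc hc hy)]

lemma image_variationOnFromTo_Icc (hab : a ≤ b) (hf : ContinuousOn f (Set.Icc a b))
    (hbv : LocallyBoundedVariationOn f (Set.Icc a b)) :
    variationOnFromTo f (Set.Icc a b) a '' Set.Icc a b =
      Set.Icc 0 (eVariationOn f (Set.Icc a b)).toReal := by
  have ha : a ∈ Set.Icc a b := Set.left_mem_Icc.2 hab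
  have hb : b ∈ Set.Icc a b := Set.right_mem_Icc.2 hab
  have h0 : variationOnFromTo f (Set.Icc a b) a a = 0 := variationOnFromTo.self _ _ _
  have h1 := variationOnFromTo_Icc (f := f) le_rfl hab (le_refl b)
  apply Set.Subset.antisymm
  · rintro _ ⟨y, hy, rfl⟩
    have hm := variationOnFromTo.monotoneOn hbv ha
    exact ⟨h0 ▸ hm ha hy hy.1, h1 ▸ hm hy hb hy.2⟩
  · rw [← h1, ← h0]
    exact intermediate_value_Icc hab (continuousOn_variationOnFromTo hf hbv ha)

lemma naturalParameterization_variationOnFromTo {s : Set ℝ}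
    (hbv : LocallyBoundedVariationOn f s) (ha : a ∈ s) {y : ℝ} (hy : y ∈ s) :
    naturalParameterization f s a (variationOnFromTo f s a y) = f y :=
  edist_eq_zero.1 (edist_naturalParameterization_eq_zero hbv ha hy)

/-- Unit speed makes the parametrization 1-Lipschitz. Continuity supplies the measurability behind
additivity of the arc integral. -/
lemma continuousOn_naturalParameterization (hab : a ≤ b) (hf : ContinuousOn f (Set.Icc a b))
    (hbv : LocallyBoundedVariationOn f (Set.Icc a b)) :
    ContinuousOn (naturalParameterization f (Set.Icc a b) a)
      (Set.Icc 0 (eVariationOn f (Set.Icc a b)).toReal) := by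
  have hu := has_unit_speed_naturalParameterization f hbv (Set.left_mem_Icc.2 hab)
  rw [image_variationOnFromTo_Icc hab hf hbv] at hu
  refine LipschitzOnWith.continuousOn (K := 1) fun x hx y hy => ?_
  wlog hxy : x ≤ y generalizing x y
  · rw [edist_comm, edist_comm x y]
    exact this y hy x hx (le_of_not_ge hxy)
  have h := hu hx hy
  calc edist _ _ ≤ _ := eVariationOn.edist_le _ (s := _ ∩ Set.Icc x y)
        ⟨hx, le_rfl, hxy⟩ ⟨hy, hxy, le_rfl⟩
    _ = _ := h
    _ = _ := by
      rw [edist_comm, edist_dist, Real.dist_eq, abs_of_nonneg (sub_nonneg.2 hxy)]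
      simp

lemma aemeasurable_comp_naturalParameterization {ρ : X → ℝ≥0∞} (hρ : Measurable[borel X] ρ)
    (hab : a ≤ b) (hf : ContinuousOn f (Set.Icc a b))
    (hbv : LocallyBoundedVariationOn f (Set.Icc a b)) :
    AEMeasurable (fun s => ρ (naturalParameterization f (Set.Icc a b) a s))
      (volume.restrict (Set.Icc 0 (eVariationOn f (Set.Icc a b)).toReal)) := by
  let _ : MeasurableSpace X := borel X
  have : BorelSpace X := ⟨rfl⟩
  exact hρ.comp_aemeasurable
    ((continuousOn_naturalParameterization hab hf hbv).aemeasurable measurableSet_Icc)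

lemma arcIntegral_add {ρ σ : X → ℝ≥0∞} (hρ : Measurable[borel X] ρ)
    (hab : a ≤ b) (hf : ContinuousOn f (Set.Icc a b))
    (hbv : LocallyBoundedVariationOn f (Set.Icc a b)) :
    arcIntegral (ρ + σ) f a b = arcIntegral ρ f a b + arcIntegral σ f a b :=
  lintegral_add_left' (aemeasurable_comp_naturalParameterization hρ hab hf hbv) _

/-- The arc length parametrization of the subcurve is that of the whole curve translated by the
length `t` from `a` to `c`, and Lebesgue measure is translation invariant. -/
lemma arcIntegral_le_of_Icc_subset (ρ : X → ℝ≥0∞) {c d : ℝ} (hac : a ≤ c) (hcd : c ≤ d)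
    (hdb : d ≤ b) (hf : ContinuousOn f (Set.Icc a b))
    (hbv : LocallyBoundedVariationOn f (Set.Icc a b)) :
    arcIntegral ρ f c d ≤ arcIntegral ρ f a b := by
  have hsub : Set.Icc c d ⊆ Set.Icc a b := Set.Icc_subset_Icc hac hdb
  have ha : a ∈ Set.Icc a b := ⟨le_rfl, hac.trans (hcd.trans hdb)⟩
  have hc : c ∈ Set.Icc a b := ⟨hac, hcd.trans hdb⟩
  have hbv' : LocallyBoundedVariationOn f (Set.Icc c d) := fun x y hx hy =>
    (hbv x y (hsub hx) (hsub hy)).mono (Set.inter_subset_inter_left _ hsub)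
  set t := variationOnFromTo f (Set.Icc a b) a c with ht
  have hadd : ∀ y ∈ Set.Icc c d, t + variationOnFromTo f (Set.Icc c d) c y =
      variationOnFromTo f (Set.Icc a b) a y := by
    intro y hy
    rw [ht, variationOnFromTo_Icc le_rfl hy.1 hy.2, ← variationOnFromTo_Icc hac hy.1 (hsub hy).2]
    exact variationOnFromTo.add hbv ha hc (hsub hy)
  have hshift : ∀ s ∈ Set.Icc 0 (eVariationOn f (Set.Icc c d)).toReal,
      naturalParameterization f (Set.Icc c d) c s =
        naturalParameterization f (Set.Icc a b) a (t + s) ∧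
      t + s ∈ Set.Icc 0 (eVariationOn f (Set.Icc a b)).toReal := by
    intro s hs
    rw [← image_variationOnFromTo_Icc hcd (hf.mono hsub) hbv'] at hs
    obtain ⟨y, hy, rfl⟩ := hs
    rw [hadd y hy, naturalParameterization_variationOnFromTo hbv' (Set.left_mem_Icc.2 hcd) hy,
      naturalParameterization_variationOnFromTo hbv ha (hsub hy)]
    refine ⟨rfl, ?_⟩
    rw [← image_variationOnFromTo_Icc ha.2 hf hbv]
    exact Set.mem_image_of_mem _ (hsub hy)
  calc arcIntegral ρ f c d
      = ∫⁻ s in Set.Icc 0 (eVariationOn f (Set.Icc c d)).toReal,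
          ρ (naturalParameterization f (Set.Icc a b) a (t + s)) :=
        setLIntegral_congr_fun measurableSet_Icc fun s hs => by
          simp only [(hshift s hs).1]
    _ ≤ ∫⁻ s in (t + ·) ⁻¹' Set.Icc 0 (eVariationOn f (Set.Icc a b)).toReal,
          ρ (naturalParameterization f (Set.Icc a b) a (t + s)) :=
        lintegral_mono_set fun s hs => (hshift s hs).2
    _ = arcIntegral ρ f a b :=
        (measurePreserving_add_left volume t).setLIntegral_comp_preimage_emb
          (measurableEmbedding_addLeft t)
          (fun s => ρ (naturalParameterization f (Set.Icc a b) a s)) _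

end ArcLength

/-! ### Line integrals -/

section LineIntegral

variable {X : Type*} [MetricSpace X]

lemma lineIntegral_mono {ρ σ : X → ℝ≥0∞} (h : ρ ≤ σ) (γ : Curve X) :
    lineIntegral ρ γ ≤ lineIntegral σ γ := by
  unfold lineIntegral arcIntegral
  gcongr
  exact h _

lemma lineIntegral_const_mul {c : ℝ≥0∞} (hc : c ≠ ∞) (ρ : X → ℝ≥0∞) (γ : Curve X) :
    lineIntegral (fun x => c * ρ x) γ = c * lineIntegral ρ γ := by
  simp only [lineIntegral, arcIntegral, lintegral_const_mul' _ _ hc, ENNReal.mul_iSup]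

lemma lineIntegral_eq_arcIntegral (ρ : X → ℝ≥0∞) {γ : Curve X} {a b : ℝ} (hab : a ≤ b)
    (hdom : γ.dom = Set.Icc a b) : lineIntegral ρ γ = arcIntegral ρ γ.toFun a b := by
  apply le_antisymm
  · refine iSup_le fun c => iSup_le fun d => iSup_le fun hc => iSup_le fun hd =>
      iSup_le fun hcd => ?_
    rw [hdom] at hc hd
    exact arcIntegral_le_of_Icc_subset ρ hc.1 hcd hd.2 (hdom ▸ γ.continuousOn)
      (hdom ▸ γ.locallyRectifiable)
  · refine le_iSup_of_le a <| le_iSup_of_le b <| le_iSup_of_le ?_ <| le_iSup_of_le ?_ <|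
      le_iSup_of_le hab le_rfl
    · exact hdom ▸ Set.left_mem_Icc.2 hab
    · exact hdom ▸ Set.right_mem_Icc.2 hab

lemma lineIntegral_add {ρ σ : X → ℝ≥0∞} (hρ : Measurable[borel X] ρ) {γ : Curve X} {a b : ℝ}
    (hab : a ≤ b) (hdom : γ.dom = Set.Icc a b) :
    lineIntegral (ρ + σ) γ = lineIntegral ρ γ + lineIntegral σ γ := by
  simp only [lineIntegral_eq_arcIntegral _ hab hdom]
  exact arcIntegral_add hρ hab (hdom ▸ γ.continuousOn) (hdom ▸ γ.locallyRectifiable)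

end LineIntegral

/-! ### Borel functions on a space that carries another `σ`-algebra -/

section Borel

variable {X : Type*} [MetricSpace X]

lemma measurable_borel_add {g g' : X → ℝ≥0∞} (hg : Measurable[borel X] g)
    (hg' : Measurable[borel X] g') : Measurable[borel X] (g + g') := by
  let _ : MeasurableSpace X := borel X
  exact hg.add hg'

lemma measurable_borel_const_mul {g : X → ℝ≥0∞} (hg : Measurable[borel X] g) (c : ℝ≥0∞) :
    Measurable[borel X] fun x => c * g x := by
  let _ : MeasurableSpace X := borel X
  exact hg.const_mul c

lemma measurable_borel_iSup {ι : Type*} [Countable ι] {g : ι → X → ℝ≥0∞}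
    (hg : ∀ i, Measurable[borel X] (g i)) : Measurable[borel X] fun x => ⨆ i, g i x := by
  let _ : MeasurableSpace X := borel X
  exact Measurable.iSup hg

lemma measurable_borel_iInf {ι : Type*} [Countable ι] {g : ι → X → ℝ≥0∞}
    (hg : ∀ i, Measurable[borel X] (g i)) : Measurable[borel X] fun x => ⨅ i, g i x := by
  let _ : MeasurableSpace X := borel X
  exact Measurable.iInf hg

lemma measurableSet_borel_lt {g g' : X → ℝ≥0∞} (hg : Measurable[borel X] g)
    (hg' : Measurable[borel X] g') : MeasurableSet[borel X] {x | g x < g' x} := by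
  let _ : MeasurableSpace X := borel X
  exact measurableSet_lt hg hg'

lemma measurable_borel_indicator_const {s : Set X} (hs : MeasurableSet[borel X] s) (c : ℝ≥0∞) :
    Measurable[borel X] (s.indicator fun _ => c) := by
  let _ : MeasurableSpace X := borel X
  exact measurable_const.indicator hs

end Borel

/-! ### Modulus -/

section Modulus

variable {X : Type*} [MetricSpace X] [MeasurableSpace X] {μ : Measure X} {p : ℝ}

lemma measurable_of_borel [OpensMeasurableSpace X] {g : X → ℝ≥0∞} (hg : Measurable[borel X] g) :
    Measurable g :=
  hg.mono (OpensMeasurableSpace.borel_le (α := X)) le_rfl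

lemma AlmostEveryCurve.mono {P Q : Curve X → Prop} (h : AlmostEveryCurve μ p P)
    (hPQ : ∀ γ, P γ → Q γ) : AlmostEveryCurve μ p Q := by
  refine le_antisymm (le_of_le_of_eq ?_ h) zero_le
  exact iInf_mono fun ρ => iInf_mono' fun hρ =>
    ⟨⟨hρ.1, fun γ hγ => hρ.2 γ fun hP => hγ (hPQ γ hP)⟩, le_rfl⟩

lemma lintegral_iSup_rpow_le [OpensMeasurableSpace X] {ι : Type*} [Countable ι] (hp : 0 < p)
    {ρ : ι → X → ℝ≥0∞} (hρ : ∀ i, Measurable[borel X] (ρ i)) :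
    ∫⁻ x, (⨆ i, ρ i x) ^ p ∂μ ≤ ∑' i, ∫⁻ x, ρ i x ^ p ∂μ := by
  rw [← lintegral_tsum fun i => ((measurable_of_borel (hρ i)).pow_const p).aemeasurable]
  refine lintegral_mono fun x => ?_
  have : (⨆ i, ρ i x) ^ p = ⨆ i, ρ i x ^ p :=
    (ENNReal.orderIsoRpow p hp).map_iSup fun i => ρ i x
  simp only [this]
  exact iSup_le fun i => ENNReal.le_tsum (f := fun i => ρ i x ^ p) i

/-- Countable subadditivity for null families: the supremum of near-optimal admissible functions is
admissible for the union, and its `p`-th power is at most the sum of theirs. -/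
lemma almostEveryCurve_all [OpensMeasurableSpace X] {ι : Type*} [Countable ι] (hp : 0 < p)
    {P : ι → Curve X → Prop} (h : ∀ i, AlmostEveryCurve μ p (P i)) :
    AlmostEveryCurve μ p fun γ => ∀ i, P i γ := by
  refine le_antisymm (ENNReal.le_of_forall_pos_le_add fun ε hε _ => ?_) zero_le
  obtain ⟨δ, hδ, hsum⟩ := ENNReal.exists_pos_sum_of_countable'
    (ENNReal.coe_pos.2 hε).ne' ι
  have hex : ∀ i, ∃ ρ ∈ Admissible {γ | ¬ P i γ}, ∫⁻ x, ρ x ^ p ∂μ < δ i := by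
    intro i
    have : modulus μ p {γ | ¬ P i γ} < δ i := (h i).trans_lt (hδ i)
    simpa only [modulus, iInf_lt_iff, exists_prop] using this
  choose ρ hρ hlt using hex
  have hadm : (fun x => ⨆ i, ρ i x) ∈ Admissible {γ | ¬ ∀ i, P i γ} := by
    refine ⟨measurable_borel_iSup fun i => (hρ i).1, fun γ hγ => ?_⟩
    obtain ⟨i, hi⟩ := not_forall.1 hγ
    exact ((hρ i).2 γ hi).trans (lineIntegral_mono (fun x => le_iSup (fun i => ρ i x) i) γ)
  calc modulus μ p {γ | ¬ ∀ i, P i γ} ≤ ∫⁻ x, (⨆ i, ρ i x) ^ p ∂μ := iInf₂_le _ hadm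
    _ ≤ ∑' i, ∫⁻ x, ρ i x ^ p ∂μ := lintegral_iSup_rpow_le hp fun i => (hρ i).1
    _ ≤ ∑' i, δ i := ENNReal.tsum_le_tsum fun i => (hlt i).le
    _ ≤ 0 + ε := by rw [zero_add]; exact hsum.le

lemma AlmostEveryCurve.and [OpensMeasurableSpace X] (hp : 0 < p) {P Q : Curve X → Prop}
    (hP : AlmostEveryCurve μ p P) (hQ : AlmostEveryCurve μ p Q) :
    AlmostEveryCurve μ p fun γ => P γ ∧ Q γ :=
  (almostEveryCurve_all (P := fun b : Bool => if b then P else Q) hp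
    (by rintro (_ | _) <;> simpa)).mono fun _ h => ⟨h true, h false⟩

/-- Every multiple `c * ρ` with `0 < c < ∞` is admissible for the curves of infinite integral; let
`c = 1 / n → 0`. -/
lemma almostEveryCurve_lineIntegral_ne_top (hp : 0 < p) {ρ : X → ℝ≥0∞}
    (hρ : Measurable[borel X] ρ) (hfin : ∫⁻ x, ρ x ^ p ∂μ < ∞) :
    AlmostEveryCurve μ p fun γ => lineIntegral ρ γ ≠ ∞ := by
  have hadm : ∀ c : ℝ≥0∞, c ≠ 0 → c ≠ ∞ →
      modulus μ p {γ | ¬ lineIntegral ρ γ ≠ ∞} ≤ c ^ p * ∫⁻ x, ρ x ^ p ∂μ := by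
    intro c hc hc'
    have : (fun x => c * ρ x) ∈ Admissible {γ | ¬ lineIntegral ρ γ ≠ ∞} := by
      refine ⟨measurable_borel_const_mul hρ c, fun γ hγ => ?_⟩
      rw [lineIntegral_const_mul hc', not_not.1 hγ, ENNReal.mul_top hc]
      exact le_top
    refine (iInf₂_le _ this).trans_eq ?_
    simp only [ENNReal.mul_rpow_of_nonneg _ _ hp.le]
    exact lintegral_const_mul' _ _ (ENNReal.rpow_ne_top_of_nonneg hp.le hc')
  have hlim : Tendsto (fun n : ℕ => ((n : ℝ≥0∞)⁻¹) ^ p * ∫⁻ x, ρ x ^ p ∂μ) atTop (𝓝 0) := by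
    have h := ((ENNReal.continuous_rpow_const (y := p)).tendsto 0).comp
      ENNReal.tendsto_inv_nat_nhds_zero
    rw [ENNReal.zero_rpow_of_pos hp] at h
    simpa using ENNReal.Tendsto.mul_const h (Or.inr hfin.ne)
  refine le_antisymm (ge_of_tendsto hlim ?_) zero_le
  filter_upwards [eventually_ne_atTop 0] with n hn
  exact hadm _ (ENNReal.inv_ne_zero.2 (ENNReal.natCast_ne_top n))
    (ENNReal.inv_ne_top.2 (by exact_mod_cast hn))

/-- The oscillation hypothesis covers both `u n = v + (u n - v)` and `v = u n - (u n - v)`. -/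
lemma IsWeakUpperGradient.add_of_abs_sub_le [OpensMeasurableSpace X] (hp : 0 < p)
    {u u' w : X → ℝ} {g g' : X → ℝ≥0∞} (h : IsWeakUpperGradient μ p u g)
    (h' : IsWeakUpperGradient μ p u' g')
    (hw : ∀ x y, |w x - w y| ≤ |u x - u y| + |u' x - u' y|) :
    IsWeakUpperGradient μ p w (g + g') := by
  refine ⟨measurable_borel_add h.1 h'.1, (h.2.and hp h'.2).mono fun γ hγ a b hab hdom => ?_⟩
  rw [lineIntegral_add h.1 hab hdom]
  refine (ENNReal.ofReal_le_ofReal (hw _ _)).trans ?_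
  rw [ENNReal.ofReal_add (abs_nonneg _) (abs_nonneg _)]
  exact add_le_add (hγ.1 a b hab hdom) (hγ.2 a b hab hdom)

lemma LocallyPIntegrable.add [OpensMeasurableSpace X] (hp : 1 ≤ p) {g g' : X → ℝ≥0∞}
    (hgm : Measurable[borel X] g) (hg : LocallyPIntegrable μ p g)
    (hg' : LocallyPIntegrable μ p g') : LocallyPIntegrable μ p (g + g') := fun K hK =>
  ENNReal.lintegral_rpow_add_lt_top_of_lintegral_rpow_lt_top
    (measurable_of_borel hgm).aemeasurable (hg K hK) (hg' K hK) hp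

lemma locallyPIntegrable_of_lintegral_lt_top {g : X → ℝ≥0∞} (hg : ∫⁻ x, g x ^ p ∂μ < ∞) :
    LocallyPIntegrable μ p g := fun K _ => (setLIntegral_le_lintegral K _).trans_lt hg

/-- A Borel function that dominates weak upper gradients of `v` up to error terms `2⁻ⁿ H`, with `H`
in `L^p`, is a weak upper gradient of `v`. -/
lemma isWeakUpperGradient_of_le_add [OpensMeasurableSpace X] (hp : 0 < p) {v : X → ℝ}
    {G H : X → ℝ≥0∞} {F : ℕ → X → ℝ≥0∞} (hG : Measurable[borel X] G)
    (hH : Measurable[borel X] H) (hHfin : ∫⁻ x, H x ^ p ∂μ < ∞)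
    (hF : ∀ n, IsWeakUpperGradient μ p v (F n))
    (hle : ∀ n x, F n x ≤ G x + 2⁻¹ ^ n * H x) : IsWeakUpperGradient μ p v G := by
  refine ⟨hG, ((almostEveryCurve_all hp fun n => (hF n).2).and hp
    (almostEveryCurve_lineIntegral_ne_top hp hH hHfin)).mono fun γ hγ a b hab hdom => ?_⟩
  have hpow : Tendsto (fun n : ℕ => (2⁻¹ : ℝ≥0∞) ^ n) atTop (𝓝 0) :=
    ENNReal.tendsto_pow_atTop_nhds_zero_of_lt_one (by norm_num)
  have hlim : Tendsto (fun n : ℕ => lineIntegral G γ + 2⁻¹ ^ n * lineIntegral H γ) atTop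
      (𝓝 (lineIntegral G γ)) := by
    simpa using (ENNReal.Tendsto.mul_const hpow (Or.inr hγ.2)).const_add (lineIntegral G γ)
  refine ge_of_tendsto' hlim fun n => (hγ.1 n a b hab hdom).trans ?_
  rw [← lineIntegral_const_mul (by finiteness), ← lineIntegral_add hG hab hdom]
  exact lineIntegral_mono (hle n) γ

end Modulus

/-! ### Limits of minimal weak upper gradients -/

section Limit

variable {X : Type*} [MetricSpace X] [MeasurableSpace X] [OpensMeasurableSpace X] {μ : Measure X}
  {p : ℝ}

lemma exists_isMinimalWeakUpperGradient_of_approx (hp : 1 ≤ p) {u : ℕ → X → ℝ} {v : X → ℝ}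
    {g h : ℕ → X → ℝ≥0∞} {H : X → ℝ≥0∞}
    (hg : ∀ n, IsMinimalWeakUpperGradient μ p (u n) (g n))
    (hgfin : ∀ n, ∫⁻ x, g n x ^ p ∂μ < ∞)
    (hh : ∀ n, IsWeakUpperGradient μ p (fun x => u n x - v x) (h n))
    (hH : Measurable[borel X] H) (hHfin : ∫⁻ x, H x ^ p ∂μ < ∞)
    (hhH : ∀ n x, h n x ≤ 2⁻¹ ^ n * H x) :
    ∃ G : X → ℝ≥0∞, IsMinimalWeakUpperGradient μ p v G ∧ ∫⁻ x, G x ^ p ∂μ < ∞ := by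
  have hp0 : 0 < p := zero_lt_one.trans_le hp
  have hhfin : ∀ n, ∫⁻ x, h n x ^ p ∂μ < ∞ := fun n =>
    (lintegral_mono fun x => ENNReal.rpow_le_rpow ((hhH n x).trans
      (mul_le_of_le_one_left zero_le (pow_le_one₀ zero_le (by norm_num)))) hp0.le).trans_lt hHfin
  -- comparison of `g n` with an arbitrary competitor for `v`
  have hcomp : ∀ (n) (g' : X → ℝ≥0∞), IsWeakUpperGradient μ p v g' → LocallyPIntegrable μ p g' →
      g n ≤ᵐ[μ] g' + h n := fun n g' hg' hloc =>
    (hg n).2.2 _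
      (hg'.add_of_abs_sub_le hp0 (hh n) fun x y => by
        refine le_of_eq_of_le ?_ (abs_add_le _ _)
        congr 1
        ring)
      (hloc.add hp hg'.1 (locallyPIntegrable_of_lintegral_lt_top (hhfin n)))
  have hF : ∀ n, IsWeakUpperGradient μ p v (g n + h n) := fun n =>
    (hg n).1.add_of_abs_sub_le hp0 (hh n) fun x y => by
      refine le_of_eq_of_le ?_ (abs_sub _ _)
      congr 1
      ring
  have hFfin : ∀ n, ∫⁻ x, (g n + h n) x ^ p ∂μ < ∞ := fun n =>
    ENNReal.lintegral_rpow_add_lt_top_of_lintegral_rpow_lt_top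
      (measurable_of_borel (hg n).1.1).aemeasurable (hgfin n) (hhfin n) hp
  set G : X → ℝ≥0∞ := fun x => ⨅ n, (g n + h n) x with hGdef
  have hG : Measurable[borel X] G :=
    measurable_borel_iInf fun n => (hF n).1
  -- The set where the bound `g n + h n ≤ G + 2 * h n` fails for some `n`.
  set N : Set X := ⋃ n, {x | G x + 2 * h n x < (g n + h n) x} with hNdef
  have hNmeas : MeasurableSet[borel X] N :=
    @MeasurableSet.iUnion _ _ (borel X) _ _ fun n =>
      measurableSet_borel_lt
        (measurable_borel_add hG (measurable_borel_const_mul (hh n).1 2)) (hF n).1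
  have hN : ∀ᵐ x ∂μ, x ∉ N := by
    have : ∀ n, ∀ᵐ x ∂μ, ∀ m, g n x ≤ (g m + h m) x + h n x := fun n =>
      ae_all_iff.2 fun m =>
        hcomp n _ (hF m) (locallyPIntegrable_of_lintegral_lt_top (hFfin m))
    filter_upwards [ae_all_iff.2 this] with x hx
    simp only [hNdef, Set.mem_iUnion, Set.mem_ofPred_eq, not_exists, not_lt]
    intro n
    rw [hGdef, ENNReal.iInf_add]
    refine le_iInf fun m => ?_
    calc (g n + h n) x ≤ ((g m + h m) x + h n x) + h n x := add_le_add (hx n m) le_rfl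
      _ = _ := by rw [add_assoc, two_mul]
  -- Line integrals see null sets, so the bound must hold everywhere; the value `∞` on the null
  -- Borel set `N` achieves this without changing the `L^p` integral.
  set G' : X → ℝ≥0∞ := G + N.indicator fun _ => ∞ with hG'def
  have hG' : Measurable[borel X] G' :=
    measurable_borel_add hG (measurable_borel_indicator_const hNmeas ∞)
  have hGG' : G' =ᵐ[μ] G := by
    filter_upwards [hN] with x hx
    simp [hG'def, hx]
  have hG'fin : ∫⁻ x, G' x ^ p ∂μ < ∞ := by
    rw [lintegral_congr_ae (hGG'.mono fun x hx => by simp only [hx] :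
      (fun x => G' x ^ p) =ᵐ[μ] fun x => G x ^ p)]
    exact (lintegral_mono fun x =>
      ENNReal.rpow_le_rpow (iInf_le _ 0) hp0.le).trans_lt (hFfin 0)
  have h2H : ∫⁻ x, (2 * H x) ^ p ∂μ < ∞ := by
    simp only [ENNReal.mul_rpow_of_nonneg _ _ hp0.le]
    rw [lintegral_const_mul' _ _ (by finiteness)]
    exact ENNReal.mul_lt_top (by finiteness) hHfin
  have h2h : ∀ n x, 2 * h n x ≤ 2⁻¹ ^ n * (2 * H x) := fun n x => by
    rw [mul_left_comm]
    gcongr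
    exact hhH n x
  refine ⟨G', ⟨isWeakUpperGradient_of_le_add hp0 hG'
    (measurable_borel_const_mul hH 2) h2H hF fun n x => ?_,
    locallyPIntegrable_of_lintegral_lt_top hG'fin, fun g' hg' hloc => ?_⟩, hG'fin⟩
  · by_cases hx : x ∈ N
    · simp [hG'def, hx]
    · have hx' : (g n + h n) x ≤ G x + 2 * h n x := by
        simp only [hNdef, Set.mem_iUnion, Set.mem_ofPred_eq, not_exists, not_lt] at hx
        exact hx n
      exact hx'.trans (add_le_add (by simp [hG'def]) (h2h n x))
  · have hHtop : ∀ᵐ x ∂μ, (2 * H x) ^ p < ∞ := ae_lt_top'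
      (((measurable_of_borel hH).const_mul 2).pow_const p).aemeasurable h2H.ne
    filter_upwards [hGG', ae_all_iff.2 fun n => hcomp n g' hg' hloc, hHtop] with x hx hle htop
    rw [hx]
    have hne : 2 * H x ≠ ∞ := fun htop' => by
      rw [htop', ENNReal.top_rpow_of_pos hp0] at htop
      exact htop.ne rfl
    have hpow : Tendsto (fun n : ℕ => (2⁻¹ : ℝ≥0∞) ^ n) atTop (𝓝 0) :=
      ENNReal.tendsto_pow_atTop_nhds_zero_of_lt_one (by norm_num)
    have hlim : Tendsto (fun n : ℕ => g' x + 2⁻¹ ^ n * (2 * H x)) atTop (𝓝 (g' x)) := by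
      simpa using (ENNReal.Tendsto.mul_const hpow (Or.inr hne)).const_add (g' x)
    refine ge_of_tendsto' hlim fun n => ?_
    calc G x ≤ g n x + h n x := iInf_le _ n
      _ ≤ (g' x + h n x) + h n x := add_le_add (hle n) le_rfl
      _ = g' x + 2 * h n x := by rw [add_assoc, two_mul]
      _ ≤ _ := add_le_add le_rfl (h2h n x)

/-- Choosing indices with summable `∫ (2 ^ k * h k) ^ p` puts `H = ⨆ k, 2 ^ k * h k` in `L^p`, and
`h k ≤ 2⁻¹ ^ k * H` by construction. The indices need not increase. -/
lemma exists_isMinimalWeakUpperGradient_of_tendsto_energy (hp : 1 ≤ p) {u : ℕ → X → ℝ} {v : X → ℝ}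
    (hu : ∀ n, ∃ g : X → ℝ≥0∞, IsMinimalWeakUpperGradient μ p (u n) g ∧ ∫⁻ x, g x ^ p ∂μ < ∞)
    (hv : Tendsto (fun n => energy μ p (fun x => u n x - v x)) atTop (𝓝 0)) :
    ∃ g : X → ℝ≥0∞, IsMinimalWeakUpperGradient μ p v g ∧ ∫⁻ x, g x ^ p ∂μ < ∞ := by
  have hp0 : 0 < p := zero_lt_one.trans_le hp
  obtain ⟨δ, hδ, hsum⟩ := ENNReal.exists_pos_sum_of_countable' one_ne_zero ℕ
  have hc0 : ∀ k : ℕ, ((2 : ℝ≥0∞) ^ k) ^ p ≠ 0 := fun k =>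
    (ENNReal.rpow_pos (by positivity) (by finiteness)).ne'
  have hct : ∀ k : ℕ, ((2 : ℝ≥0∞) ^ k) ^ p ≠ ∞ := fun k => by finiteness
  have hex : ∀ k : ℕ, ∃ n, ∃ h : X → ℝ≥0∞,
      IsMinimalWeakUpperGradient μ p (fun x => u n x - v x) h ∧
        ∫⁻ x, h x ^ p ∂μ < δ k / (2 ^ k) ^ p := fun k => by
    obtain ⟨n, hn⟩ := (hv.eventually_lt_const (ENNReal.div_pos (hδ k).ne' (hct k))).exists
    -- Finite energy forces a minimal gradient to exist, since the infimum over the empty family is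
    -- `∞`.
    simp only [energy, iInf_lt_iff, exists_prop] at hn
    exact ⟨n, hn⟩
  choose n h hh hlt using hex
  choose g hg hgfin using hu
  have hm : ∀ k, Measurable[borel X] fun x => 2 ^ k * h k x := fun k =>
    measurable_borel_const_mul (hh k).1.1 _
  refine exists_isMinimalWeakUpperGradient_of_approx hp (fun k => hg (n k)) (fun k => hgfin (n k))
    (fun k => (hh k).1) (H := fun x => ⨆ k, 2 ^ k * h k x)
    (measurable_borel_iSup hm) ?_ fun k x => ?_
  · refine (lintegral_iSup_rpow_le hp0 hm).trans_lt
      ((ENNReal.tsum_le_tsum fun k => ?_).trans_lt (hsum.trans ENNReal.one_lt_top))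
    simp only [ENNReal.mul_rpow_of_nonneg _ _ hp0.le]
    rw [lintegral_const_mul' _ _ (hct k)]
    calc _ ≤ ((2 : ℝ≥0∞) ^ k) ^ p * (δ k / (2 ^ k) ^ p) := by gcongr; exact (hlt k).le
      _ = δ k := ENNReal.mul_div_cancel (hc0 k) (hct k)
  · calc h k x = 2⁻¹ ^ k * (2 ^ k * h k x) := by
          rw [← mul_assoc, ← mul_pow, ENNReal.inv_mul_cancel two_ne_zero ENNReal.ofNat_ne_top,
            one_pow, one_mul]
      _ ≤ _ := by gcongr; exact le_iSup (fun k => 2 ^ k * h k x) k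

end Limit

end Royden

theorem theorem2p4 {X : Type*} [MetricSpace X] [LocallyCompactSpace X] [NoncompactSpace X]
    [CompleteSpace X] [Nontrivial X] [MeasurableSpace X] [OpensMeasurableSpace X]
    (μ : Measure X) [μ.IsComplete] (hdoubling : Royden.IsDoubling μ)
    (hball : ∀ (x : X) (r : ℝ), 0 < r → 0 < μ (Metric.ball x r) ∧ μ (Metric.ball x r) < ∞)
    (p : ℝ) (hp : 1 < p)
    (u : ℕ → X → ℝ) (hu : ∀ n, u n ∈ Royden.BD μ p) (hbdd : Royden.UniformlyBounded u)
    (v : X → ℝ) (hv : Royden.TendstoBD μ p u v) :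
    v ∈ Royden.BD μ p := by
  obtain ⟨⟨hunif, henergy⟩, -⟩ := hv
  obtain ⟨M, hM⟩ := hbdd
  have hloc : TendstoLocallyUniformly u v atTop :=
    tendstoLocallyUniformly_iff_forall_isCompact.2 hunif
  refine ⟨hloc.continuous (Frequently.of_forall fun n => (hu n).1), ⟨M, fun x => ?_⟩,
    Royden.exists_isMinimalWeakUpperGradient_of_tendsto_energy hp.le (fun n => (hu n).2.2) henergy⟩
  have hx : Tendsto (fun n => u n x) atTop (𝓝 (v x)) :=
    (hunif {x} isCompact_singleton).tendsto_at (Set.mem_singleton x)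
  exact le_of_tendsto' hx.abs fun n => hM n x
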